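/- Let $\mathcal S,\mathcal U$ be Borel spaces (Borel subsets of complete separable metric spaces, with their Borel $\sigma$-algebras), let $\mathbb K\subseteq\mathcal S\times\mathcal U$ be a measurable set such that every section $\mathcal U(s)=\{u:(s,u)\in\mathbb K\}$ is nonempty, let $Q$ be a stochastic kernel on $\mathcal S$ given $\mathbb K$, let $r:\mathbb K\to\mathbb R$ be measurable, and let $\alpha\in[0,1)$. A randomized policy $\pi=(\pi_t)_{t\ge 0}\in\Pi$ is a sequence of stochastic kernels $\pi_t$ on $\mathcal U$ given $\mathbb K^t\times\mathcal S$ with $\pi_t(\mathcal U(s_t)\mid h_t)=1$ for every $h_t=(s_0,u_0,\dots,s_{t-1},u_{t-1},s_t)$. Let $$V(\pi,s)=\mathbb E^\pi_s\Big[\sum_{t\ge 0}\alpha^t r(s_t,u_t)\Big],\qquad V^*(s)=\sup_{\pi\in\Pi}V(\pi,s),$$ where the expectation is taken under the law of the process with $s_0=s$, $u_t\sim\pi_t(\cdot\mid h_t)$ and $s_{t+1}\sim Q(\cdot\mid s_t,u_t)$. The measurized model has the probability measures $\nu$ on $\mathcal S$ as its states; its actions, all of them feasible from every $\nu$, are the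 stochastic kernels $\varphi$ on $\mathcal U$ given $\mathcal S$ with $\varphi(\mathcal U(s)\mid s)=1$ for all $s$. Its transition is deterministic, from $\nu$ to $F(\nu,\varphi)(\cdot)=\int_{\mathcal S}\int_{\mathcal U}Q(\cdot\mid s,u)\,\varphi(du\mid s)\,\nu(ds)$, and its reward is $\overline r(\nu,\varphi)=\int_{\mathcal S}\int_{\mathcal U}r(s,u)\,\varphi(du\mid s)\,\nu(ds)$. The pairs $(\nu,\varphi)$ carry the $\sigma$-algebra generated by the joint laws $\varphi(du\mid s)\,\nu(ds)$, that is, the coarsest one that makes $(\nu,\varphi)\mapsto\varphi(du\mid s)\,\nu(ds)$ measurable. Let $\overline V^*(\nu)$ be the supremum, over all randomized history-dependent policies of the measurized model, of the expected value of $\sum_{t\ge 0}\alpha^t\,\overline r(\nu_t,\varphi_t)$ started from $\nu_0=\nu$. Assume that 1. $r$ is upper semicontinuous and bounded (above and below), and $\{u\in\mathcal U(s):r(s,u)\ge c\}$ is compact for all $s\in\mathcal S$ and $c\in\mathbb R$; 2. $Q$ is strongly continuous: $(s,u)\mapsto\int g(s')\,Q(ds'\mid s,u)$ is continuous on $\mathbb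 K$ for every bounded measurable $g:\mathcal S\to\mathbb R$; 3. there is a policy whose expected discounted reward is finite from every initial state; 4. $\{(s,u)\in\mathbb K:s\in\mathcal C\}$ is compact for every compact $\mathcal C\subseteq\mathcal S$. Then for every probability measure $\nu$ on $\mathcal S$ and every sequence $s^1,s^2,\dots$ of independent random states with law $\nu$, almost surely $$\lim_{N\to\infty}\frac1N\sum_{n=1}^N V^*(s^n)=\overline V^*(\nu).$$ -/

import Mathlib

open MeasureTheory ProbabilityTheory

noncomputable section

/-- A discrete-time control model, presented through its set `Z` of feasible state-action pairs.
`state z` is the state coordinate of the pair `z` (so that the pairs feasible from the state `x`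
are the `z` with `state z = x`), `trans z` is the law of the next state when the pair `z` is used,
and `reward z` is the one-stage reward. Both the original decision model and its measurized
counterpart are of this form. -/
structure ControlModel (X Z : Type*) [MeasurableSpace X] [MeasurableSpace Z] where
  state : Z → X
  measurable_state : Measurable state
  trans : Kernel Z X
  isMarkov_trans : IsMarkovKernel trans
  reward : Z → ℝ
  measurable_reward : Measurable reward

namespace ControlModel

variable {X Z : Type*} [MeasurableSpace X] [MeasurableSpace Z]

/-- A randomized history-dependent policy. At time `t`, given the admissible history
`(z₀, …, z_{t-1}, x_t)` of earlier state-action pairs and the current state, it draws the current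
state-action pair, whose state coordinate is the current state `x_t` (so that only the action is
being chosen, among those feasible from `x_t`). -/
structure Policy (M : ControlModel X Z) where
  kernel : ∀ t : ℕ, Kernel ((Fin t → Z) × X) Z
  isMarkov : ∀ t, IsMarkovKernel (kernel t)
  feasible : ∀ t h x, ∀ᵐ z ∂(kernel t (h, x)), M.state z = x

variable {M : ControlModel X Z}

/-- The law of the pair at time `t + 1` given the pairs at times `0, …, t`: draw the next state
from the transition law at the last pair, then draw the pair from the policy. -/
def Policy.step (π : M.Policy) (t : ℕ) : Kernel ((i : Finset.Iic t) → Z) Z :=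
  π.kernel (t + 1) ∘ₖ
    (Kernel.deterministic
        (fun (h : (i : Finset.Iic t) → Z) (i : Fin (t + 1)) =>
          h ⟨i, Finset.mem_Iic.2 (Nat.lt_succ_iff.1 i.2)⟩)
        (by fun_prop)
      ×ₖ M.trans.comap (fun h : (i : Finset.Iic t) → Z => h ⟨t, Finset.mem_Iic.2 le_rfl⟩)
        (by fun_prop))

instance (π : M.Policy) (t : ℕ) : IsMarkovKernel (π.step t) := by
  have := π.isMarkov (t + 1)
  have := M.isMarkov_trans
  unfold Policy.step
  infer_instance

/-- The law of the pair at time `0` given the initial state. -/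
def Policy.init (π : M.Policy) : Kernel X Z :=
  (π.kernel 0).comap (fun x => (Fin.elim0, x)) (by fun_prop)

/-- The Ionescu-Tulcea law of the whole sequence of state-action pairs when the initial state has
law `μ` and the policy `π` is used. -/
def Policy.law (π : M.Policy) (μ : Measure X) : Measure (ℕ → Z) :=
  Kernel.trajMeasure (X := fun _ => Z) (π.init ∘ₘ μ) π.step

/-- The discounted return of a sequence of state-action pairs. -/
def discountedReturn (M : ControlModel X Z) (α : ℝ) (ω : ℕ → Z) : ℝ :=
  ∑' t : ℕ, α ^ t * M.reward (ω t)

/-- The expected discounted reward of the policy `π` from the initial state `x`. -/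
def Policy.value (π : M.Policy) (α : ℝ) (x : X) : ℝ :=
  ∫ ω, M.discountedReturn α ω ∂(π.law (Measure.dirac x))

/-- The optimal value over all randomized history-dependent policies. -/
def optimalValue (M : ControlModel X Z) (α : ℝ) (x : X) : ℝ :=
  ⨆ π : M.Policy, π.value α x

end ControlModel

/-- A Markov decision model with states `S` and actions `U`: a measurable set `K` of feasible
state-action pairs with nonempty sections `U(s)`, a transition law on `S` given `K`, and a
measurable reward on `K`. -/
structure MarkovDecisionModel (S U : Type*) [MeasurableSpace S] [MeasurableSpace U] where
  K : Set (S × U)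
  measurableSet_K : MeasurableSet K
  nonempty_K : ∀ s, ∃ u, (s, u) ∈ K
  Q : Kernel K S
  isMarkov_Q : IsMarkovKernel Q
  r : K → ℝ
  measurable_r : Measurable r

namespace MarkovDecisionModel

variable {S U : Type*} [MeasurableSpace S] [MeasurableSpace U]

/-- The set `U(s)` of feasible actions at the state `s`. -/
def actions (M : MarkovDecisionModel S U) (s : S) : Set U := {u | (s, u) ∈ M.K}

/-- The model seen through its feasible state-action pairs. -/
def toControlModel (M : MarkovDecisionModel S U) : ControlModel S M.K where
  state k := k.1.1
  measurable_state := by fun_prop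
  trans := M.Q
  isMarkov_trans := M.isMarkov_Q
  reward := M.r
  measurable_reward := M.measurable_r

/-- If `κ a` is a law on actions concentrated on `U(σ a)`, then `M.pairKernel σ κ a` is the law of
the feasible pair `(σ a, u)` with `u` drawn from `κ a`. -/
def pairKernel (M : MarkovDecisionModel S U) {A : Type*} [MeasurableSpace A] (σ : A → S)
    (hσ : Measurable σ) (κ : Kernel A U) : Kernel A M.K :=
  (Kernel.deterministic σ hσ ×ₖ κ).comapRight (MeasurableEmbedding.subtype_coe M.measurableSet_K)

lemma pairKernel_apply (M : MarkovDecisionModel S U) {A : Type*} [MeasurableSpace A] (σ : A → S)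
    (hσ : Measurable σ) (κ : Kernel A U) [IsMarkovKernel κ] (a : A) {B : Set M.K}
    (hB : MeasurableSet B) :
    M.pairKernel σ hσ κ a B = κ a {u | ∃ h : (σ a, u) ∈ M.K, (⟨(σ a, u), h⟩ : M.K) ∈ B} := by
  have hB' : MeasurableSet ((fun k : M.K => (k : S × U)) '' B) :=
    (MeasurableEmbedding.subtype_coe M.measurableSet_K).measurableSet_image' hB
  rw [pairKernel, Kernel.comapRight_apply' _ _ _ hB, Kernel.prod_apply, Kernel.deterministic_apply,
    Measure.prod_apply hB', lintegral_dirac' _ (measurable_measure_prodMk_left hB')]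
  congr 1
  ext u
  simp

lemma map_pairKernel (M : MarkovDecisionModel S U) {A : Type*} [MeasurableSpace A] (σ : A → S)
    (hσ : Measurable σ) (κ : Kernel A U) [IsMarkovKernel κ] (hκ : ∀ a, κ a (M.actions (σ a)) = 1) :
    (M.pairKernel σ hσ κ).map (fun k => k.1.1) = Kernel.deterministic σ hσ := by
  have hf : Measurable fun k : M.K => k.1.1 := by fun_prop
  ext a B hB
  rw [Kernel.map_apply' _ hf _ hB, pairKernel_apply _ _ _ _ _ (hf hB),
    Kernel.deterministic_apply' hσ _ hB]
  by_cases h : σ a ∈ B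
  · rw [Set.indicator_of_mem h, ← hκ a]
    congr 1
    ext u
    simp [actions, h]
  · simp [h]

lemma isMarkovKernel_pairKernel (M : MarkovDecisionModel S U) {A : Type*} [MeasurableSpace A]
    (σ : A → S) (hσ : Measurable σ) (κ : Kernel A U) [IsMarkovKernel κ]
    (hκ : ∀ a, κ a (M.actions (σ a)) = 1) : IsMarkovKernel (M.pairKernel σ hσ κ) := by
  refine ⟨fun a => ⟨?_⟩⟩
  rw [pairKernel_apply _ _ _ _ _ MeasurableSet.univ, ← hκ a]
  congr 1
  ext u
  simp [actions]

/-- A randomized control policy: stochastic kernels on the actions given the admissible histories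
`(s₀, u₀, …, s_{t-1}, u_{t-1}, s_t)`, concentrated on the actions feasible at the current state. -/
structure Policy (M : MarkovDecisionModel S U) where
  kernel : ∀ t : ℕ, Kernel ((Fin t → M.K) × S) U
  isMarkov : ∀ t, IsMarkovKernel (kernel t)
  feasible : ∀ t h s, kernel t (h, s) (M.actions s) = 1

/-- A randomized control policy, read as the choice of the current state-action pair. -/
def Policy.toControlPolicy [MeasurableSingletonClass S] {M : MarkovDecisionModel S U} (π : M.Policy) :
    M.toControlModel.Policy where
  kernel t := M.pairKernel Prod.snd measurable_snd (π.kernel t)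
  isMarkov t :=
    have := π.isMarkov t
    M.isMarkovKernel_pairKernel _ _ _ fun a => π.feasible t a.1 a.2
  feasible t h s := by
    have := π.isMarkov t
    have hm : MeasurableSet {k : M.K | k.1.1 = s}ᶜ :=
      ((measurableSet_singleton s).preimage M.toControlModel.measurable_state).compl
    rw [ae_iff]
    refine (M.pairKernel_apply Prod.snd measurable_snd (π.kernel t) (h, s) hm).trans ?_
    simp

/-- The value `V(π, s)`: the expected discounted reward of the policy `π` from the state `s`. -/
def Policy.value [MeasurableSingletonClass S] {M : MarkovDecisionModel S U} (π : M.Policy) (α : ℝ) (s : S) : ℝ :=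
  π.toControlPolicy.value α s

/-- The optimal value function `V*` of the decision model. -/
def optimalValue [MeasurableSingletonClass S] (M : MarkovDecisionModel S U) (α : ℝ) (s : S) : ℝ :=
  ⨆ π : M.Policy, π.value α s

/-- The set `Φ` of Markov decision rules: stochastic kernels `φ` on the actions given the states
with `φ(U(s) | s) = 1` for every `s`. -/
structure DecisionRule (M : MarkovDecisionModel S U) where
  kernel : Kernel S U
  isMarkov : IsMarkovKernel kernel
  feasible : ∀ s, kernel s (M.actions s) = 1

/-- A feasible state-action pair `(ν, φ)` of the measurized model: a law `ν` on the states together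
with a decision rule `φ`. Every decision rule is feasible from every `ν`. -/
structure LiftedPair (M : MarkovDecisionModel S U) where
  dist : ProbabilityMeasure S
  rule : M.DecisionRule

/-- The joint law `γ(ds, du) = φ(du | s) ν(ds)` of a feasible pair of the original model when the
state is drawn from `ν` and the action from `φ`. -/
def LiftedPair.joint {M : MarkovDecisionModel S U} (p : M.LiftedPair) : ProbabilityMeasure M.K :=
  ⟨M.pairKernel id measurable_id p.rule.kernel ∘ₘ (p.dist : Measure S), by
    have := p.rule.isMarkov
    have := M.isMarkovKernel_pairKernel id measurable_id p.rule.kernel p.rule.feasible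
    infer_instance⟩

/-- Pairs `(ν, φ)` are measured through the joint laws that they determine. -/
instance (M : MarkovDecisionModel S U) : MeasurableSpace M.LiftedPair :=
  MeasurableSpace.comap LiftedPair.joint inferInstance

lemma LiftedPair.measurable_joint {M : MarkovDecisionModel S U} :
    Measurable (LiftedPair.joint : M.LiftedPair → ProbabilityMeasure M.K) :=
  comap_measurable _

lemma LiftedPair.map_joint {M : MarkovDecisionModel S U} (p : M.LiftedPair) :
    (p.joint : Measure M.K).map (fun k => k.1.1) = p.dist := by
  have := p.rule.isMarkov
  have hf : Measurable fun k : M.K => k.1.1 := by fun_prop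
  change (M.pairKernel id measurable_id p.rule.kernel ∘ₘ (p.dist : Measure S)).map _ = _
  rw [Measure.map_comp _ _ hf, M.map_pairKernel id measurable_id p.rule.kernel p.rule.feasible, Measure.deterministic_comp_eq_map,
    Measure.map_id]

/-- The deterministic transition `F(ν, φ)(B) = ∫∫ Q(B | s, u) φ(du | s) ν(ds)`. -/
def LiftedPair.next {M : MarkovDecisionModel S U} (p : M.LiftedPair) : ProbabilityMeasure S :=
  ⟨M.Q ∘ₘ (p.joint : Measure M.K), by
    have := M.isMarkov_Q
    infer_instance⟩

/-- The lifted reward `∫∫ r(s, u) φ(du | s) ν(ds)`, the integral of `r` against the joint law. -/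
def LiftedPair.reward {M : MarkovDecisionModel S U} (p : M.LiftedPair) : ℝ :=
  ∫ k, M.r k ∂(p.joint : Measure M.K)

lemma LiftedPair.measurable_dist {M : MarkovDecisionModel S U} :
    Measurable (LiftedPair.dist : M.LiftedPair → ProbabilityMeasure S) := by
  refine Measurable.subtype_mk (f := fun p : M.LiftedPair => (p.dist : Measure S)) ?_
  simp_rw [← LiftedPair.map_joint]
  exact (Measure.measurable_map _ (by fun_prop)).comp
    (measurable_subtype_coe.comp LiftedPair.measurable_joint)

lemma LiftedPair.measurable_next {M : MarkovDecisionModel S U} :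
    Measurable (LiftedPair.next : M.LiftedPair → ProbabilityMeasure S) :=
  Measurable.subtype_mk ((Measure.measurable_bind' M.Q.measurable).comp
    (measurable_subtype_coe.comp LiftedPair.measurable_joint))

lemma LiftedPair.measurable_reward {M : MarkovDecisionModel S U} :
    Measurable (LiftedPair.reward : M.LiftedPair → ℝ) := by
  let κ : Kernel M.LiftedPair M.K := ⟨fun p => (p.joint : Measure M.K),
    measurable_subtype_coe.comp LiftedPair.measurable_joint⟩
  exact (M.measurable_r.stronglyMeasurable.integral_kernel (κ := κ)).measurable

/-- The measurized counterpart of the model: the states are the laws `ν` on `S`, the actions are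
the decision rules, all of them feasible from every `ν`, the next state is `F(ν, φ)`, with
certainty, and the reward is the expected reward. -/
def measurized (M : MarkovDecisionModel S U) :
    ControlModel (ProbabilityMeasure S) M.LiftedPair where
  state := LiftedPair.dist
  measurable_state := LiftedPair.measurable_dist
  trans := Kernel.deterministic LiftedPair.next LiftedPair.measurable_next
  isMarkov_trans := inferInstance
  reward := LiftedPair.reward
  measurable_reward := LiftedPair.measurable_reward

/-- The optimal value function of the measurized counterpart. -/
def measurizedOptimalValue (M : MarkovDecisionModel S U) (α : ℝ) (ν : ProbabilityMeasure S) : ℝ :=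
  M.measurized.optimalValue α ν

section Assumptions

variable [TopologicalSpace S] [TopologicalSpace U]

/-- The reward is upper semicontinuous, bounded above, and sup-compact on `K`. -/
structure RewardRegular (M : MarkovDecisionModel S U) : Prop where
  upperSemicontinuous : UpperSemicontinuous M.r
  bddAbove : BddAbove (Set.range M.r)
  supCompact : ∀ (s : S) (c : ℝ), IsCompact {u : U | ∃ h : (s, u) ∈ M.K, c ≤ M.r ⟨(s, u), h⟩}

/-- The transition law is strongly continuous: it maps bounded measurable functions to continuous
functions on `K`. -/
def StronglyContinuous (M : MarkovDecisionModel S U) : Prop :=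
  ∀ g : S → ℝ, Measurable g → (∃ C, ∀ s, |g s| ≤ C) → Continuous fun k : M.K => ∫ s, g s ∂(M.Q k)

/-- Some policy has a finite expected discounted reward from every initial state. -/
def HasFinitePolicy [MeasurableSingletonClass S] (M : MarkovDecisionModel S U) (α : ℝ) : Prop :=
  ∃ π : M.Policy, ∀ s, Integrable (M.toControlModel.discountedReturn α)
    (π.toControlPolicy.law (Measure.dirac s))

/-- The feasible pairs over a compact set of states form a compact set. -/
def CompactOverCompact (M : MarkovDecisionModel S U) : Prop :=
  ∀ C : Set S, IsCompact C → IsCompact {k : S × U | k ∈ M.K ∧ k.1 ∈ C}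

end Assumptions

end MarkovDecisionModel

end

noncomputable section

/-! Both optimal values come from one bounded measurable function `v`, the fixed point of the
optimality operator: the original value is `v` and the measurized value is `ν ↦ ∫ v dν`. The strong
law applied to `v (s^n)` then gives the limit.

For any bounded measurable `w`, telescoping gives `V(π, x) - w(x) = ∑ α^t E[gap(z_t)]`, where `gap =
reward + α ∫ w d(trans) - w(state)` (`Policy.hasSum_bellmanGap`). If the gap is nonpositive, `w`
bounds every policy; a policy that keeps to pairs of zero gap attains `w`. Since this holds in any
`ControlModel`, it serves both models.

The fixed point exists because strong continuity makes `∫ v dQ` continuous even when `v` is only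
measurable. So `r + α ∫ v dQ` is upper semicontinuous on `K`, and compactness over compacts gives a
measurable maximum and a measurable maximizing selector (`exists_measurable_maximizer`). The
operator thus acts on bounded measurable functions and contracts by `α`.

The lift rests on linearity: the gap of `ν ↦ ∫ v dν` at `(ν, φ)` is the mean of the original gap
under the joint law (`bellmanGap_measurized`). It is therefore nonpositive, and zero when `φ` is the
maximizing selector, whatever `ν` is. -/

lemma integral_comp_measure {A B : Type*} [MeasurableSpace A] [MeasurableSpace B] {κ : Kernel A B}
    {μ : Measure A} {f : B → ℝ} (hf : Integrable f (κ ∘ₘ μ)) :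
    ∫ b, f b ∂(κ ∘ₘ μ) = ∫ a, ∫ b, f b ∂(κ a) ∂μ := by
  have h : κ ∘ₘ μ = (κ ∘ₖ Kernel.const Unit μ) () := by
    rw [Kernel.comp_apply, Kernel.const_apply]
  rw [h] at hf ⊢
  rw [Kernel.integral_comp hf, Kernel.const_apply]

/-! ### Marginals of the trajectory law and verification by the optimality gap. -/

namespace ControlModel

variable {X Z : Type*} [MeasurableSpace X] [MeasurableSpace Z] {M : ControlModel X Z}

lemma Policy.map_state_kernel (π : M.Policy) (t : ℕ) :
    (π.kernel t).map M.state = Kernel.deterministic Prod.snd measurable_snd := by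
  have := π.isMarkov t
  ext1 ⟨h, x⟩
  rw [Kernel.map_apply _ M.measurable_state, Kernel.deterministic_apply]
  rw [Measure.map_congr (g := fun _ => x) (π.feasible t h x)]
  simp

lemma Policy.map_state_init (π : M.Policy) : π.init.map M.state = Kernel.id := by
  ext1 x
  rw [Kernel.map_apply _ M.measurable_state, Policy.init, Kernel.comap_apply,
    ← Kernel.map_apply _ M.measurable_state, π.map_state_kernel]
  simp [Kernel.deterministic_apply, Kernel.id_apply]

/-- The policy drops out: feasibility leaves it only the choice of the action, so the next state
keeps its transition law. -/
lemma Policy.map_state_step (π : M.Policy) (t : ℕ) :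
    (π.step t).map M.state =
      M.trans.comap (fun h : (i : Finset.Iic t) → Z => h ⟨t, Finset.mem_Iic.2 le_rfl⟩)
        (by fun_prop) := by
  have := M.isMarkov_trans
  rw [Policy.step, Kernel.map_comp, π.map_state_kernel, Kernel.deterministic_comp_eq_map,
    ← Kernel.snd_eq, Kernel.snd_prod]

instance (π : M.Policy) : IsMarkovKernel π.init := by
  have := π.isMarkov 0
  unfold Policy.init
  infer_instance

section Law

variable (π : M.Policy) (μ : Measure X)

instance [IsProbabilityMeasure μ] : IsProbabilityMeasure (π.law μ) := by
  unfold Policy.law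
  infer_instance

lemma Policy.map_zero_law : (π.law μ).map (fun ω => ω 0) = π.init ∘ₘ μ := by
  have hf : (fun ω : ℕ → Z => ω 0) =
      (MeasurableEquiv.piUnique (fun _ : Finset.Iic 0 => Z)) ∘
        (Preorder.frestrictLe (π := fun _ : ℕ => Z) 0) := rfl
  rw [hf, ← Measure.map_map (by fun_prop) (by fun_prop), Policy.law, Kernel.trajMeasure,
    Measure.map_comp _ _ (by fun_prop), Kernel.traj_map_frestrictLe, Kernel.partialTraj_self,
    Measure.id_comp, Measure.map_map (by fun_prop) (by fun_prop), MeasurableEquiv.self_comp_symm,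
    Measure.map_id]

lemma Policy.map_state_zero_law : (π.law μ).map (fun ω => M.state (ω 0)) = μ := by
  have hm := M.measurable_state
  have h1 : (fun ω : ℕ → Z => M.state (ω 0)) = M.state ∘ (fun ω => ω 0) := rfl
  rw [h1, ← Measure.map_map hm (by fun_prop), π.map_zero_law, Measure.map_comp _ _ hm,
    π.map_state_init, Measure.id_comp]

variable [IsProbabilityMeasure μ]

lemma Policy.map_succ_law (t : ℕ) : (π.law μ).map (fun ω => ω (t + 1)) =
    π.step t ∘ₘ (π.law μ).map (Preorder.frestrictLe (π := fun _ : ℕ => Z) t) := by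
  have h := Kernel.map_frestrictLe_trajMeasure_compProd_eq_map_trajMeasure
    (X := fun _ => Z) (μ₀ := π.init ∘ₘ μ) (κ := π.step) (a := t)
  have h2 := congrArg Measure.snd h
  rw [Measure.snd_compProd, Measure.snd, Measure.map_map (by fun_prop) (by fun_prop)] at h2
  exact h2.symm

lemma Policy.map_state_succ_law (t : ℕ) : (π.law μ).map (fun ω => M.state (ω (t + 1))) =
    M.trans ∘ₘ (π.law μ).map (fun ω => ω t) := by
  have hm := M.measurable_state
  have h1 : (fun ω : ℕ → Z => M.state (ω (t + 1))) = M.state ∘ (fun ω => ω (t + 1)) := rfl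
  rw [h1, ← Measure.map_map hm (by fun_prop), π.map_succ_law, Measure.map_comp _ _ hm,
    π.map_state_step, ← Kernel.comp_deterministic_eq_comap, ← Measure.comp_assoc,
    Measure.deterministic_comp_eq_map, Measure.map_map (by fun_prop) (by fun_prop)]
  rfl

/-- A property that the policy enforces at every stage holds almost surely along the process. -/
lemma Policy.ae_law {p : Z → Prop} (hp : MeasurableSet {z | p z})
    (h : ∀ t a, ∀ᵐ z ∂(π.kernel t a), p z) (t : ℕ) : ∀ᵐ ω ∂(π.law μ), p (ω t) := by
  have key : ∀ᵐ z ∂((π.law μ).map fun ω => ω t), p z := by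
    cases t with
    | zero =>
      rw [π.map_zero_law, Measure.ae_comp_iff hp]
      exact Filter.Eventually.of_forall fun x => h 0 _
    | succ t =>
      rw [π.map_succ_law, Policy.step, ← Measure.comp_assoc, Measure.ae_comp_iff hp]
      exact Filter.Eventually.of_forall fun x => h (t + 1) x
  exact (ae_map_iff (measurable_pi_apply t).aemeasurable hp).1 key

end Law

/-- The excess of the pair `z` over the function `w` in the optimality equation. -/
def bellmanGap (M : ControlModel X Z) (α : ℝ) (w : X → ℝ) (z : Z) : ℝ :=
  M.reward z + α * ∫ x, w x ∂(M.trans z) - w (M.state z)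

lemma measurable_bellmanGap (α : ℝ) {w : X → ℝ} (hw : Measurable w) :
    Measurable (M.bellmanGap α w) := by
  have := M.isMarkov_trans
  have h1 : Measurable fun z => ∫ x, w x ∂(M.trans z) :=
    (hw.stronglyMeasurable.integral_kernel (κ := M.trans)).measurable
  exact (M.measurable_reward.add (h1.const_mul α)).sub (hw.comp M.measurable_state)

/-- The performance of a policy, measured against a bounded function of the state. -/
lemma Policy.hasSum_bellmanGap (π : M.Policy) {α C D : ℝ} (hα0 : 0 ≤ α) (hα1 : α < 1)
    (hC : ∀ z, |M.reward z| ≤ C) {w : X → ℝ} (hw : Measurable w) (hD : ∀ x, |w x| ≤ D) (x : X) :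
    HasSum (fun t => α ^ t * ∫ ω, M.bellmanGap α w (ω t) ∂(π.law (Measure.dirac x)))
      (π.value α x - w x) := by
  have := M.isMarkov_trans
  have hr := M.measurable_reward
  have hs := M.measurable_state
  set L := π.law (Measure.dirac x) with hL
  have hmr : ∀ t, Measurable fun ω : ℕ → Z => M.reward (ω t) := fun t =>
    hr.comp (measurable_pi_apply t)
  have hms : ∀ t, Measurable fun ω : ℕ → Z => M.state (ω t) := fun t =>
    hs.comp (measurable_pi_apply t)
  have h1 : Measurable fun z => ∫ x, w x ∂(M.trans z) :=
    (hw.stronglyMeasurable.integral_kernel (κ := M.trans)).measurable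
  have hbound : ∀ z, |∫ x, w x ∂(M.trans z)| ≤ D := fun z => by
    have := norm_integral_le_of_norm_le_const (μ := M.trans z) (f := w) (C := D)
      (Filter.Eventually.of_forall hD)
    simpa using this
  have hintr : ∀ t, Integrable (fun ω => M.reward (ω t)) L := fun t =>
    Integrable.of_bound (hmr t).aestronglyMeasurable C (Filter.Eventually.of_forall fun ω => hC _)
  have hintw : ∀ t, Integrable (fun ω => w (M.state (ω t))) L := fun t =>
    Integrable.of_bound (hw.comp (hms t)).aestronglyMeasurable D (Filter.Eventually.of_forall fun ω => hD _)
  have hintQ : ∀ t, Integrable (fun ω : ℕ → Z => ∫ x, w x ∂(M.trans (ω t))) L := fun t =>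
    Integrable.of_bound (h1.comp (measurable_pi_apply t)).aestronglyMeasurable D
      (Filter.Eventually.of_forall fun ω => hbound _)
  let a : ℕ → ℝ := fun t => ∫ ω, w (M.state (ω t)) ∂L
  have hgeo : Summable fun t : ℕ => α ^ t := summable_geometric_of_lt_one hα0 hα1
  have hnext : ∀ t, ∫ ω, ∫ x, w x ∂(M.trans (ω t)) ∂L = a (t + 1) := fun t => by
    have e1 : a (t + 1) = ∫ y, w y ∂(L.map fun ω => M.state (ω (t + 1))) :=
      (integral_map (hms _).aemeasurable hw.aestronglyMeasurable).symm
    have hi : Integrable w (M.trans ∘ₘ L.map fun ω => ω t) := by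
      have : IsProbabilityMeasure (L.map fun ω => ω t) :=
        Measure.isProbabilityMeasure_map (measurable_pi_apply t).aemeasurable
      exact Integrable.of_bound hw.aestronglyMeasurable D (Filter.Eventually.of_forall hD)
    rw [e1, π.map_state_succ_law, integral_comp_measure hi,
      integral_map (measurable_pi_apply t).aemeasurable h1.aestronglyMeasurable]
  have hzero : a 0 = w x := by
    have e1 : a 0 = ∫ y, w y ∂(L.map fun ω => M.state (ω 0)) :=
      (integral_map (hms _).aemeasurable hw.aestronglyMeasurable).symm
    rw [e1, π.map_state_zero_law, integral_dirac' _ _ hw.stronglyMeasurable]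
  have hgap : ∀ t, ∫ ω, M.bellmanGap α w (ω t) ∂L =
      ∫ ω, M.reward (ω t) ∂L + α * a (t + 1) - a t := fun t => by
    unfold bellmanGap
    have e := integral_sub ((hintr t).add ((hintQ t).const_mul α)) (hintw t)
    rw [integral_add' (hintr t) ((hintQ t).const_mul α), integral_const_mul, hnext] at e
    exact e
  have hvalue : HasSum (fun t => α ^ t * ∫ ω, M.reward (ω t) ∂L) (π.value α x) := by
    have := hasSum_integral_of_summable_integral_norm (μ := L)
      (F := fun t ω => α ^ t * M.reward (ω t)) (fun t => (hintr t).const_mul _) ?_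
    · simp only [integral_const_mul] at this
      exact this
    · refine Summable.of_nonneg_of_le (fun t => integral_nonneg fun _ => norm_nonneg _)
        (fun t => ?_) (hgeo.mul_right C)
      calc ∫ ω, ‖α ^ t * M.reward (ω t)‖ ∂L ≤ ∫ ω, α ^ t * C ∂L := by
            refine integral_mono ((hintr t).const_mul _).norm (integrable_const _) fun ω => ?_
            change ‖α ^ t * M.reward (ω t)‖ ≤ α ^ t * C
            rw [norm_mul, norm_pow, Real.norm_of_nonneg hα0]
            exact mul_le_mul_of_nonneg_left (hC _) (pow_nonneg hα0 t)
        _ = α ^ t * C := by simp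
  have habound : ∀ t, |a t| ≤ D := fun t => by
    have := norm_integral_le_of_norm_le_const (μ := L) (f := fun ω => w (M.state (ω t))) (C := D)
      (Filter.Eventually.of_forall fun ω => hD _)
    simpa using this
  have hsa : Summable fun t => α ^ t * a t := by
    refine Summable.of_norm_bounded (hgeo.mul_right D) fun t => ?_
    rw [norm_mul, norm_pow, Real.norm_of_nonneg hα0]
    exact mul_le_mul_of_nonneg_left (habound t) (pow_nonneg hα0 t)
  have htail : HasSum (fun t => α ^ (t + 1) * a (t + 1)) (∑' t, α ^ t * a t - w x) := by
    have := (hasSum_nat_add_iff' (f := fun t => α ^ t * a t) 1).2 hsa.hasSum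
    simpa [hzero] using this
  -- The shifted series and the full one differ only in the term at time `0`, which is `w x`.
  have h := (hvalue.add htail).sub hsa.hasSum
  rw [show π.value α x + (∑' t, α ^ t * a t - w x) - ∑' t, α ^ t * a t = π.value α x - w x by
    ring] at h
  have e : (fun t => α ^ t * ∫ ω, M.bellmanGap α w (ω t) ∂L) = fun t =>
      α ^ t * ∫ ω, M.reward (ω t) ∂L + α ^ (t + 1) * a (t + 1) - α ^ t * a t := by
    funext t
    rw [hgap]
    ring
  rw [e]
  exact h

lemma Policy.value_le (π : M.Policy) {α C D : ℝ} (hα0 : 0 ≤ α) (hα1 : α < 1)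
    (hC : ∀ z, |M.reward z| ≤ C) {w : X → ℝ} (hw : Measurable w) (hD : ∀ x, |w x| ≤ D)
    (hle : ∀ z, M.bellmanGap α w z ≤ 0) (x : X) : π.value α x ≤ w x := by
  have := (π.hasSum_bellmanGap hα0 hα1 hC hw hD x).nonpos fun t =>
    mul_nonpos_of_nonneg_of_nonpos (pow_nonneg hα0 t) (integral_nonpos fun ω => hle _)
  linarith

lemma Policy.value_eq (π : M.Policy) {α C D : ℝ} (hα0 : 0 ≤ α) (hα1 : α < 1)
    (hC : ∀ z, |M.reward z| ≤ C) {w : X → ℝ} (hw : Measurable w) (hD : ∀ x, |w x| ≤ D)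
    (heq : ∀ t a, ∀ᵐ z ∂(π.kernel t a), M.bellmanGap α w z = 0) (x : X) :
    π.value α x = w x := by
  have h := π.hasSum_bellmanGap hα0 hα1 hC hw hD x
  have hz : ∀ t, ∫ ω, M.bellmanGap α w (ω t) ∂(π.law (Measure.dirac x)) = 0 := fun t =>
    integral_eq_zero_of_ae (π.ae_law _
      (measurable_bellmanGap α hw (measurableSet_singleton 0)) heq t)
  simp only [hz, mul_zero] at h
  linarith [h.unique hasSum_zero]

end ControlModel

/-! ### Measurable selection from compact-valued correspondences. -/

/-- The correspondence of the maximizers of `G` within `A`. -/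
def maximizers {S U : Type*} (A : S → Set U) (G : S → U → ℝ) (s : S) : Set U :=
  {u ∈ A s | ∀ v ∈ A s, G s v ≤ G s u}

lemma maximizers_subset {S U : Type*} (A : S → Set U) (G : S → U → ℝ) (s : S) : maximizers A G s ⊆ A s :=
  fun _ hu => hu.1

section Selection

variable {S U : Type*} [MeasurableSpace S] [TopologicalSpace U]

/-- A correspondence with nonempty compact values whose weak inverse images of closed sets are
measurable. -/
structure IsMeasurableCompact (A : S → Set U) : Prop where
  isCompact : ∀ s, IsCompact (A s)
  nonempty : ∀ s, (A s).Nonempty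
  measurableSet_inter : ∀ F, IsClosed F → MeasurableSet {s | (A s ∩ F).Nonempty}

/-- The measurable maximum theorem. -/
lemma isMeasurableCompact_maximizers {A : S → Set U} (hA : IsMeasurableCompact A)
    {G : S → U → ℝ} (hG : ∀ s, UpperSemicontinuousOn (G s) (A s))
    (hm : ∀ c F, IsClosed F → MeasurableSet {s | ∃ u ∈ A s ∩ F, c ≤ G s u}) :
    IsMeasurableCompact (maximizers A G) := by
  have hmax : ∀ s, ∃ u ∈ A s, ∀ v ∈ A s, G s v ≤ G s u := fun s =>
    (hG s).exists_isMaxOn (hA.nonempty s) (hA.isCompact s)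
  refine ⟨fun s => ?_, fun s => ?_, fun F hF => ?_⟩
  · obtain ⟨u, hu, hmu⟩ := hmax s
    have he : maximizers A G s = A s ∩ G s ⁻¹' Set.Ici (G s u) := by
      ext v
      exact ⟨fun hv => ⟨hv.1, hv.2 u hu⟩, fun hv => ⟨hv.1, fun w hw => (hmu w hw).trans hv.2⟩⟩
    rw [he]
    exact (hG s).isCompact_inter_preimage_Ici (hA.isCompact s) _
  · obtain ⟨u, hu, hmu⟩ := hmax s
    exact ⟨u, hu, hmu⟩
  -- Some maximizer lies in `F` exactly when every rational level reached on `A s` is also reached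
  -- on `A s ∩ F`. A level below the maximum also forces `A s ∩ F` to be nonempty.
  · have he : {s | (maximizers A G s ∩ F).Nonempty} = ⋂ q : ℚ,
        ({s | ∃ u ∈ A s ∩ Set.univ, (q : ℝ) ≤ G s u}ᶜ ∪ {s | ∃ u ∈ A s ∩ F, (q : ℝ) ≤ G s u}) := by
      ext s
      simp only [Set.mem_iInter, Set.mem_union, Set.mem_compl_iff, Set.mem_ofPred_eq,
        Set.inter_univ, ← imp_iff_not_or]
      constructor
      · rintro ⟨u, hu, huF⟩ q ⟨v, hv, hq⟩
        exact ⟨u, ⟨hu.1, huF⟩, hq.trans (hu.2 v hv)⟩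
      · intro h
        obtain ⟨u, hu, hmu⟩ := hmax s
        have hne : (A s ∩ F).Nonempty := by
          obtain ⟨q, hq⟩ := exists_rat_lt (G s u)
          obtain ⟨v, hv, -⟩ := h q ⟨u, hu, hq.le⟩
          exact ⟨v, hv⟩
        obtain ⟨v, hv, hmv⟩ := ((hG s).mono Set.inter_subset_left).exists_isMaxOn hne
          ((hA.isCompact s).inter_right hF)
        refine ⟨v, ⟨hv.1, fun w hw => (hmu w hw).trans ?_⟩, hv.2⟩
        by_contra! hlt
        obtain ⟨q, hq1, hq2⟩ := exists_rat_btwn hlt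
        obtain ⟨w, hw, hqw⟩ := h q ⟨u, hu, hq2.le⟩
        exact absurd (hmv hw) (not_le.2 (hq1.trans_le hqw))
    rw [he]
    exact MeasurableSet.iInter fun q => (hm q _ isClosed_univ).compl.union (hm q F hF)

/-- For continuous `f` the constraint `c ≤ f u` is closed, so it can be absorbed into `F`. -/
lemma isMeasurableCompact_maximizers_continuous {A : S → Set U} (hA : IsMeasurableCompact A)
    {f : U → ℝ} (hf : Continuous f) : IsMeasurableCompact (maximizers A fun _ => f) := by
  refine isMeasurableCompact_maximizers hA (fun s => hf.upperSemicontinuous.upperSemicontinuousOn _) fun c F hF => ?_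
  convert hA.measurableSet_inter (F ∩ f ⁻¹' Set.Ici c) (hF.inter (isClosed_Ici.preimage hf)) using 3
    with s
  simp only [Set.Nonempty, Set.mem_inter_iff, Set.mem_preimage, Set.mem_Ici, and_assoc]

/-- The successive maximizers of a sequence of functions. -/
def iterMaximizers (A : S → Set U) (f : ℕ → U → ℝ) : ℕ → S → Set U
  | 0 => A
  | n + 1 => maximizers (iterMaximizers A f n) fun _ => f n

lemma isMeasurableCompact_iterMaximizers {A : S → Set U} (hA : IsMeasurableCompact A)
    {f : ℕ → U → ℝ} (hf : ∀ n, Continuous (f n)) (n : ℕ) :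
    IsMeasurableCompact (iterMaximizers A f n) := by
  induction n with
  | zero => exact hA
  | succ n ih => exact isMeasurableCompact_maximizers_continuous ih (hf n)

/-- Measurable selection, by lexicographic maximization of a separating sequence of functions. -/
lemma IsMeasurableCompact.exists_measurable_selection [TopologicalSpace.MetrizableSpace U]
    [SecondCountableTopology U] [MeasurableSpace U] [BorelSpace U] {A : S → Set U}
    (hA : IsMeasurableCompact A) : ∃ g : S → U, Measurable g ∧ ∀ s, g s ∈ A s := by
  let _ := TopologicalSpace.metrizableSpaceMetric U
  rcases isEmpty_or_nonempty S with hS | ⟨⟨s₀⟩⟩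
  · exact ⟨fun s => isEmptyElim s, measurable_of_empty _, fun s => isEmptyElim s⟩
  have : Nonempty U := ⟨(hA.nonempty s₀).some⟩
  let f : ℕ → U → ℝ := fun n u => dist u (TopologicalSpace.denseSeq U n)
  have hf : ∀ n, Continuous (f n) := fun n => continuous_id.dist continuous_const
  -- Distances to a dense sequence determine a point.
  have hsep : ∀ u v, (∀ n, f n u = f n v) → u = v := fun u v h => by
    refine dist_le_zero.1 (le_of_forall_pos_lt_add fun ε hε => ?_)
    obtain ⟨n, hn⟩ := (TopologicalSpace.denseRange_denseSeq U).exists_dist_lt u (half_pos hε)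
    have h1 : dist v (TopologicalSpace.denseSeq U n) < ε / 2 := (h n).symm.trans_lt hn
    linarith [dist_triangle_right u v (TopologicalSpace.denseSeq U n)]
  let B := iterMaximizers A f
  have hB : ∀ n, IsMeasurableCompact (B n) := isMeasurableCompact_iterMaximizers hA hf
  have hinter : ∀ s F, IsClosed F → (∀ n, (B n s ∩ F).Nonempty) → (⋂ n, B n s ∩ F).Nonempty :=
    fun s F hF h => IsCompact.nonempty_iInter_of_sequence_nonempty_isCompact_isClosed _
      (fun n => Set.inter_subset_inter_left _ (maximizers_subset _ _ s)) h
      (((hB 0).isCompact s).inter_right hF) fun n => ((hB n).isCompact s).isClosed.inter hF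
  have hne : ∀ s, ∃ u, ∀ n, u ∈ B n s := fun s => by
    obtain ⟨u, hu⟩ := hinter s Set.univ isClosed_univ fun n => by
      simpa using (hB n).nonempty s
    exact ⟨u, fun n => (Set.mem_iInter.1 hu n).1⟩
  choose g hg using hne
  -- Two points surviving every stage both maximize each `f n` over `B n s`, so no `f n` separates
  -- them.
  have huniq : ∀ s u, (∀ n, u ∈ B n s) → u = g s := fun s u hu => hsep _ _ fun n =>
    le_antisymm ((hg s (n + 1)).2 u (hu n)) ((hu (n + 1)).2 _ (hg s n))
  refine ⟨g, measurable_of_isClosed fun F hF => ?_, fun s => hg s 0⟩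
  -- If `F` meets every `B n s`, Cantor's intersection theorem puts a common point in `F`, and that
  -- point is `g s`.
  have he : g ⁻¹' F = ⋂ n, {s | (B n s ∩ F).Nonempty} := by
    ext s
    simp only [Set.mem_preimage, Set.mem_iInter, Set.mem_ofPred_eq]
    refine ⟨fun h n => ⟨g s, hg s n, h⟩, fun h => ?_⟩
    obtain ⟨u, hu⟩ := hinter s F hF h
    have hu' := Set.mem_iInter.1 hu
    exact huniq s u (fun n => (hu' n).1) ▸ (hu' 0).2
  rw [he]
  exact MeasurableSet.iInter fun n => (hB n).measurableSet_inter F hF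

end Selection

/-! ### Measurable maxima over sections that are compact over compacts. -/

section Maximum

variable {S U : Type*} [TopologicalSpace S] [TopologicalSpace.MetrizableSpace S]
  [TopologicalSpace U]

/-- A convergent sequence together with its limit is compact, so the pairs of `K` over it form a
compact set. Superlevel sets of `G` there are compact, and their projection to `S` is closed. -/
lemma isClosed_exists_le {K : Set (S × U)} {G : S × U → ℝ} (hG : UpperSemicontinuousOn G K)
    (hK : ∀ C : Set S, IsCompact C → IsCompact {k : S × U | k ∈ K ∧ k.1 ∈ C}) (c : ℝ) {F : Set U}
    (hF : IsClosed F) : IsClosed {s | ∃ u ∈ {u | (s, u) ∈ K} ∩ F, c ≤ G (s, u)} := by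
  refine IsSeqClosed.isClosed fun x s hx hs => ?_
  have hC := hs.isCompact_insert_range
  have h1 : IsCompact (({k : S × U | k ∈ K ∧ k.1 ∈ insert s (Set.range x)} ∩ G ⁻¹' Set.Ici c) ∩
      Prod.snd ⁻¹' F) :=
    ((hG.mono fun k hk => hk.1).isCompact_inter_preimage_Ici (hK _ hC) c).inter_right
      (hF.preimage continuous_snd)
  have h2 := (h1.image continuous_fst).isClosed
  have h3 := h2.mem_of_tendsto hs (Filter.Eventually.of_forall fun n => by
    obtain ⟨u, ⟨hu, huF⟩, huc⟩ := hx n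
    exact ⟨(x n, u), ⟨⟨⟨hu, Or.inr ⟨n, rfl⟩⟩, huc⟩, huF⟩, rfl⟩)
  obtain ⟨⟨s', u⟩, ⟨⟨⟨hu, -⟩, huc⟩, huF⟩, rfl⟩ := h3
  exact ⟨u, ⟨hu, huF⟩, huc⟩

/-- An upper semicontinuous function on a set that is compact over the compact sets has a measurable
maximizer over the sections, and its maximum is measurable. -/
lemma exists_measurable_maximizer [MeasurableSpace S] [BorelSpace S]
    [TopologicalSpace.MetrizableSpace U] [SecondCountableTopology U]
    [MeasurableSpace U] [BorelSpace U] {K : Set (S × U)} {G : S × U → ℝ}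
    (hne : ∀ s, ∃ u, (s, u) ∈ K) (hG : UpperSemicontinuousOn G K)
    (hK : ∀ C : Set S, IsCompact C → IsCompact {k : S × U | k ∈ K ∧ k.1 ∈ C}) :
    ∃ g : S → U, Measurable g ∧ (∀ s, (s, g s) ∈ K) ∧
      (∀ s u, (s, u) ∈ K → G (s, u) ≤ G (s, g s)) ∧ Measurable fun s => G (s, g s) := by
  have hA : IsMeasurableCompact fun s => {u | (s, u) ∈ K} := by
    refine ⟨fun s => ?_, hne, fun F hF => ?_⟩
    · convert (hK {s} isCompact_singleton).image continuous_snd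
      ext u
      simp
    -- With the zero function at level `0` the inequality is void, leaving only the condition that
    -- the section meets `F`.
    · have h0 : UpperSemicontinuousOn (fun _ : S × U => (0 : ℝ)) K :=
        continuousOn_const.upperSemicontinuousOn
      simpa [Set.Nonempty] using (isClosed_exists_le h0 hK 0 hF).measurableSet
  have hmax : IsMeasurableCompact
      (maximizers (fun s => {u | (s, u) ∈ K}) fun s u => G (s, u)) := by
    refine isMeasurableCompact_maximizers hA (fun s => ?_) fun c F hF => (isClosed_exists_le hG hK c hF).measurableSet
    exact hG.comp (g := fun u => (s, u)) (by fun_prop) fun u hu => hu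
  obtain ⟨g, hg, hgm⟩ := hmax.exists_measurable_selection
  refine ⟨g, hg, fun s => (hgm s).1, fun s u hu => (hgm s).2 u hu, measurable_of_Ici fun c => ?_⟩
  convert (isClosed_exists_le hG hK c isClosed_univ).measurableSet using 1
  ext s
  simp only [Set.mem_preimage, Set.mem_Ici, Set.inter_univ, Set.mem_ofPred_eq]
  exact ⟨fun h => ⟨g s, (hgm s).1, h⟩, fun ⟨u, hu, h⟩ => h.trans ((hgm s).2 u hu)⟩

end Maximum

/-! ### The optimality operator and its fixed point. -/

namespace MarkovDecisionModel

variable {S U : Type*} [MeasurableSpace S] [MeasurableSpace U] {M : MarkovDecisionModel S U}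

/-- `w` is the image of `v` under the optimality operator, with the supremum attained. -/
def IsBellmanImage (M : MarkovDecisionModel S U) (α : ℝ) (v w : S → ℝ) : Prop :=
  ∀ s, IsGreatest {c | ∃ u, ∃ h : (s, u) ∈ M.K,
    M.r ⟨(s, u), h⟩ + α * ∫ s', v s' ∂(M.Q ⟨(s, u), h⟩) = c} (w s)

/-- An action attaining the maximum for `v` competes in the maximum for `v'`; the rewards cancel. -/
lemma IsBellmanImage.sub_le {α ε D : ℝ} (hα0 : 0 ≤ α) {v w v' w' : S → ℝ}
    (hv : Measurable v) (hvD : ∀ s, |v s| ≤ D) (hv' : Measurable v') (hvD' : ∀ s, |v' s| ≤ D)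
    (h : M.IsBellmanImage α v w) (h' : M.IsBellmanImage α v' w') (hε : ∀ s, v s - v' s ≤ ε)
    (s : S) : w s - w' s ≤ α * ε := by
  have := M.isMarkov_Q
  obtain ⟨u, hu, he⟩ := (h s).1
  have h2 := (h' s).2 ⟨u, hu, rfl⟩
  have hi : Integrable v (M.Q ⟨(s, u), hu⟩) :=
    Integrable.of_bound hv.aestronglyMeasurable D (Filter.Eventually.of_forall hvD)
  have hi' : Integrable v' (M.Q ⟨(s, u), hu⟩) :=
    Integrable.of_bound hv'.aestronglyMeasurable D (Filter.Eventually.of_forall hvD')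
  have h3 : ∫ s', v s' ∂(M.Q ⟨(s, u), hu⟩) - ∫ s', v' s' ∂(M.Q ⟨(s, u), hu⟩) ≤ ε := by
    rw [← integral_sub hi hi']
    calc _ ≤ ∫ _, ε ∂(M.Q ⟨(s, u), hu⟩) := integral_mono (hi.sub hi') (integrable_const _) hε
      _ = ε := by simp
  have h4 := mul_le_mul_of_nonneg_left h3 hα0
  linarith

lemma IsBellmanImage.abs_sub_le {α ε D : ℝ} (hα0 : 0 ≤ α) {v w v' w' : S → ℝ}
    (hv : Measurable v) (hvD : ∀ s, |v s| ≤ D) (hv' : Measurable v') (hvD' : ∀ s, |v' s| ≤ D)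
    (h : M.IsBellmanImage α v w) (h' : M.IsBellmanImage α v' w') (hε : ∀ s, |v s - v' s| ≤ ε)
    (s : S) : |w s - w' s| ≤ α * ε := by
  have h1 := h.sub_le hα0 hv hvD hv' hvD' h' (fun s => (abs_le.1 (hε s)).2) s
  have h2 := h'.sub_le hα0 hv' hvD' hv hvD h (fun s => by linarith [(abs_le.1 (hε s)).1]) s
  exact abs_le.2 ⟨by linarith, h1⟩

/-- Keeps the iteration inside the ball of radius `D`. -/
lemma IsBellmanImage.abs_le {α C D : ℝ} (hα0 : 0 ≤ α) (hC : ∀ k, |M.r k| ≤ C)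
    (hCD : C + α * D ≤ D) {v w : S → ℝ} (hvD : ∀ s, |v s| ≤ D) (h : M.IsBellmanImage α v w)
    (s : S) : |w s| ≤ D := by
  have := M.isMarkov_Q
  obtain ⟨u, hu, he⟩ := (h s).1
  have h1 : |∫ s', v s' ∂(M.Q ⟨(s, u), hu⟩)| ≤ D := by
    simpa using norm_integral_le_of_norm_le_const (μ := M.Q ⟨(s, u), hu⟩) (f := v) (C := D)
      (Filter.Eventually.of_forall hvD)
  rw [← he]
  calc _ ≤ |M.r ⟨(s, u), hu⟩| + |α * ∫ s', v s' ∂(M.Q ⟨(s, u), hu⟩)| := abs_add_le _ _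
    _ ≤ C + α * D := by
        rw [abs_mul, abs_of_nonneg hα0]
        exact add_le_add (hC _) (mul_le_mul_of_nonneg_left h1 hα0)
    _ ≤ D := hCD

lemma exists_isBellmanImage [TopologicalSpace S] [TopologicalSpace.MetrizableSpace S] [BorelSpace S]
    [TopologicalSpace U] [TopologicalSpace.MetrizableSpace U] [SecondCountableTopology U]
    [BorelSpace U] {α D : ℝ} (hr : UpperSemicontinuous M.r)
    (hQ : M.StronglyContinuous) (hcomp : M.CompactOverCompact) {v : S → ℝ} (hv : Measurable v)
    (hvD : ∀ s, |v s| ≤ D) :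
    ∃ g : S → U, ∃ hg : ∀ s, (s, g s) ∈ M.K, Measurable g ∧ Measurable (fun s =>
      M.r ⟨(s, g s), hg s⟩ + α * ∫ s', v s' ∂(M.Q ⟨(s, g s), hg s⟩)) ∧
      M.IsBellmanImage α v fun s =>
        M.r ⟨(s, g s), hg s⟩ + α * ∫ s', v s' ∂(M.Q ⟨(s, g s), hg s⟩) := by
  classical
  let G₀ : M.K → ℝ := fun k => M.r k + α * ∫ s', v s' ∂(M.Q k)
  -- The value off `K` is immaterial: semicontinuity and maximization only concern `K`.
  let G : S × U → ℝ := fun k => if h : k ∈ M.K then G₀ ⟨k, h⟩ else 0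
  have hGG : ∀ k (h : k ∈ M.K), G k = G₀ ⟨k, h⟩ := fun k h => dif_pos h
  have hG₀ : UpperSemicontinuous G₀ :=
    hr.add (continuous_const.mul (hQ v hv ⟨D, hvD⟩)).upperSemicontinuous
  have hG : UpperSemicontinuousOn G M.K := by
    rw [← upperSemicontinuousOn_iff_restrict]
    convert hG₀ using 1
    funext k
    exact hGG k.1 k.2
  obtain ⟨g, hgm, hg, hmax, hm⟩ := exists_measurable_maximizer M.nonempty_K hG hcomp
  simp only [fun s => hGG (s, g s) (hg s)] at hm
  refine ⟨g, hg, hgm, hm, fun s => ⟨⟨g s, hg s, rfl⟩, ?_⟩⟩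
  rintro c ⟨u, hu, rfl⟩
  have := hmax s u hu
  rwa [hGG _ hu, hGG _ (hg s)] at this

/-- Picard iteration from `0`, carried out pointwise with uniform geometric bounds: measurability
and the bound `D` pass to pointwise limits. -/
lemma exists_bellman_fixedPoint [TopologicalSpace S] [TopologicalSpace.MetrizableSpace S]
    [BorelSpace S] [TopologicalSpace U] [TopologicalSpace.MetrizableSpace U]
    [SecondCountableTopology U] [BorelSpace U] {α C D : ℝ} (hα0 : 0 ≤ α) (hα1 : α < 1)
    (hC : ∀ k, |M.r k| ≤ C) (hD : 0 ≤ D) (hCD : C + α * D ≤ D) (hr : UpperSemicontinuous M.r)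
    (hQ : M.StronglyContinuous) (hcomp : M.CompactOverCompact) :
    ∃ v : S → ℝ, Measurable v ∧ (∀ s, |v s| ≤ D) ∧ M.IsBellmanImage α v v := by
  let W := {v : S → ℝ // Measurable v ∧ ∀ s, |v s| ≤ D}
  have hT : ∀ v : W, ∃ w : W, M.IsBellmanImage α v.1 w.1 := fun v => by
    obtain ⟨g, hg, -, hm, him⟩ := exists_isBellmanImage hr hQ hcomp v.2.1 v.2.2
    exact ⟨⟨_, hm, him.abs_le hα0 hC hCD v.2.2⟩, him⟩
  choose T hT using hT
  let x : ℕ → W := fun n => T^[n] ⟨fun _ => 0, measurable_const, fun _ => by simpa using hD⟩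
  have hx : ∀ n, M.IsBellmanImage α (x n).1 (x (n + 1)).1 := fun n => by
    have : x (n + 1) = T (x n) := Function.iterate_succ_apply' T n _
    exact this ▸ hT (x n)
  -- The constant `2 * D` is the diameter of the ball containing the first two iterates.
  have hstep : ∀ n s, |(x n).1 s - (x (n + 1)).1 s| ≤ 2 * D * α ^ n := fun n => by
    induction n with
    | zero =>
      intro s
      have h0 := abs_le.1 ((x 0).2.2 s)
      have h1 := abs_le.1 ((x (0 + 1)).2.2 s)
      exact _root_.abs_le.2 ⟨by linarith, by linarith⟩
    | succ n ih =>
      intro s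
      refine ((hx n).abs_sub_le hα0 (x n).2.1 (x n).2.2 (x _).2.1 (x _).2.2 (hx _) ih s).trans_eq ?_
      ring
  have hlim : ∀ s, ∃ l, Filter.Tendsto (fun n => (x n).1 s) Filter.atTop (nhds l) := fun s =>
    cauchySeq_tendsto_of_complete (cauchySeq_of_le_geometric α (2 * D) hα1 fun n => hstep n s)
  choose v hv using hlim
  have hvm : Measurable v :=
    measurable_of_tendsto_metrizable (fun n => (x n).2.1) (tendsto_pi_nhds.2 hv)
  have hvD : ∀ s, |v s| ≤ D := fun s =>
    le_of_tendsto (hv s).abs (Filter.Eventually.of_forall fun n => (x n).2.2 s)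
  have hdist : ∀ n s, |(x n).1 s - v s| ≤ 2 * D * α ^ n / (1 - α) := fun n s =>
    dist_le_of_le_geometric_of_tendsto α (2 * D) hα1 (fun n => hstep n s) (hv s) n
  -- The iterate of index `n + 1` is the image of that of index `n`, so by contraction the iterates
  -- also converge to the image of `v`.
  have hfix : (T ⟨v, hvm, hvD⟩).1 = v := by
    funext s
    refine tendsto_nhds_unique ?_ (hv s)
    refine (Filter.tendsto_add_atTop_iff_nat 1).1 (tendsto_iff_dist_tendsto_zero.2 ?_)
    refine squeeze_zero (fun _ => dist_nonneg) (fun n => (hx n).abs_sub_le hα0 (x n).2.1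
      (x n).2.2 hvm hvD (hT ⟨v, hvm, hvD⟩) (hdist n) s) ?_
    have := (((tendsto_pow_atTop_nhds_zero_of_lt_one hα0 hα1).const_mul (2 * D)).div_const
      (1 - α)).const_mul α
    simpa using this
  refine ⟨v, hvm, hvD, ?_⟩
  have := hT ⟨v, hvm, hvD⟩
  rwa [hfix] at this

lemma ae_pairKernel_deterministic {A : Type*} [MeasurableSpace A] {σ : A → S} (hσ : Measurable σ)
    {f : A → U} (hf : Measurable f) (hK : ∀ a, (σ a, f a) ∈ M.K) {p : M.K → Prop}
    (hp : MeasurableSet {k | p k}) (hpf : ∀ a, p ⟨(σ a, f a), hK a⟩) (a : A) :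
    ∀ᵐ k ∂(M.pairKernel σ hσ (Kernel.deterministic f hf) a), p k := by
  rw [ae_iff]
  refine (M.pairKernel_apply σ hσ _ a hp.compl).trans ?_
  -- Since `K` is measurable, the bad pairs form a measurable set in `S × U`, and so do their
  -- sections in `U`.
  have hB := (MeasurableEmbedding.subtype_coe M.measurableSet_K).measurableSet_image' hp.compl
  have he : {u | ∃ h : (σ a, u) ∈ M.K, (⟨(σ a, u), h⟩ : M.K) ∈ {k | p k}ᶜ} =
      Prod.mk (σ a) ⁻¹' ((fun k : M.K => (k : S × U)) '' {k | p k}ᶜ) := by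
    ext u
    exact ⟨fun ⟨h, hu⟩ => ⟨_, hu, rfl⟩, by rintro ⟨⟨k, h⟩, hk, rfl⟩; exact ⟨h, hk⟩⟩
  rw [he, Kernel.deterministic_apply' hf _ (measurable_prodMk_left hB), ← he]
  refine Set.indicator_of_notMem ?_ _
  rintro ⟨_, h⟩
  exact h (hpf a)

lemma actions_deterministic {A : Type*} [MeasurableSpace A] {σ : A → S}
    {f : A → U} (hf : Measurable f) (hK : ∀ a, (σ a, f a) ∈ M.K) (a : A) :
    Kernel.deterministic f hf a (M.actions (σ a)) = 1 := by
  rw [Kernel.deterministic_apply]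
  exact Measure.dirac_apply_of_mem (hK a)

/-- The stationary deterministic policy of a measurable selector. -/
def stationaryPolicy (M : MarkovDecisionModel S U) {g : S → U} (hg : Measurable g)
    (hK : ∀ s, (s, g s) ∈ M.K) : M.Policy where
  kernel _ := Kernel.deterministic (fun a => g a.2) (hg.comp measurable_snd)
  isMarkov _ := inferInstance
  feasible _ h s := actions_deterministic (σ := Prod.snd) _ (fun a => hK a.2) (h, s)

/-- The decision rule of a measurable selector. -/
def selectorRule (M : MarkovDecisionModel S U) {g : S → U} (hg : Measurable g)
    (hK : ∀ s, (s, g s) ∈ M.K) : M.DecisionRule where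
  kernel := Kernel.deterministic g hg
  isMarkov := inferInstance
  feasible := actions_deterministic (σ := id) hg hK

/-! ### The measurized model: measurability and the lifted gap. -/

section Lift

lemma measurable_integral_probabilityMeasure {v : S → ℝ} (hv : Measurable v) :
    Measurable fun ν : ProbabilityMeasure S => ∫ s, v s ∂(ν : Measure S) := by
  let κ : Kernel (ProbabilityMeasure S) S :=
    ⟨fun ν => (ν : Measure S), measurable_subtype_coe⟩
  exact (hv.stronglyMeasurable.integral_kernel (κ := κ)).measurable

/-- A countable generating algebra is a π-system, so equality of two laws amounts to countably many
equations. This makes the feasibility condition of a lifted policy a measurable event. -/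
lemma measurableSet_eq_probabilityMeasure [MeasurableSpace.CountablyGenerated S]
    (ν : ProbabilityMeasure S) : MeasurableSet {μ : ProbabilityMeasure S | μ = ν} := by
  obtain ⟨b, hb, hgen⟩ := MeasurableSpace.CountablyGenerated.isCountablyGenerated (α := S)
  have hc := countable_generateSetAlgebra hb
  have hgen' : ‹MeasurableSpace S› = MeasurableSpace.generateFrom (generateSetAlgebra b) :=
    hgen.trans generateFrom_generateSetAlgebra_eq.symm
  have he : {μ : ProbabilityMeasure S | μ = ν} = ⋂ B ∈ generateSetAlgebra b,
      {μ : ProbabilityMeasure S | (μ : Measure S) B = (ν : Measure S) B} := by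
    ext μ
    simp only [Set.mem_iInter, Set.mem_ofPred_eq]
    refine ⟨fun h B _ => h ▸ rfl, fun h => Subtype.ext ?_⟩
    exact ext_of_generate_finite (μ := (μ : Measure S)) (ν := (ν : Measure S)) _ hgen'
      (fun s hs t ht _ => isSetAlgebra_generateSetAlgebra.inter_mem hs ht) h (by simp)
  rw [he]
  refine MeasurableSet.biInter hc fun B hB => ?_
  have hBm : MeasurableSet B := hgen' ▸ MeasurableSpace.measurableSet_generateFrom hB
  exact ((Measure.measurable_coe hBm).comp measurable_subtype_coe) (measurableSet_singleton _)

/-- The optimality gap of a lifted pair is the mean of the gap of the original model. -/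
lemma bellmanGap_measurized {α C D : ℝ} (hC : ∀ k, |M.r k| ≤ C) {v : S → ℝ} (hv : Measurable v)
    (hvD : ∀ s, |v s| ≤ D) (p : M.LiftedPair) :
    M.measurized.bellmanGap α (fun ν => ∫ s, v s ∂(ν : Measure S)) p =
      ∫ k, M.toControlModel.bellmanGap α v k ∂(p.joint : Measure M.K) := by
  have := M.isMarkov_Q
  have hstate : Measurable fun k : M.K => k.1.1 := by fun_prop
  have hQm : Measurable fun k => ∫ s, v s ∂(M.Q k) :=
    (hv.stronglyMeasurable.integral_kernel (κ := M.Q)).measurable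
  have hQD : ∀ k, |∫ s, v s ∂(M.Q k)| ≤ D := fun k => by
    simpa using norm_integral_le_of_norm_le_const (μ := M.Q k) (f := v) (C := D)
      (Filter.Eventually.of_forall hvD)
  have i1 : Integrable M.r (p.joint : Measure M.K) :=
    Integrable.of_bound M.measurable_r.aestronglyMeasurable C (Filter.Eventually.of_forall hC)
  have i2 : Integrable (fun k => ∫ s, v s ∂(M.Q k)) (p.joint : Measure M.K) :=
    Integrable.of_bound hQm.aestronglyMeasurable D (Filter.Eventually.of_forall hQD)
  have i3 : Integrable (fun k : M.K => v k.1.1) (p.joint : Measure M.K) :=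
    Integrable.of_bound (hv.comp hstate).aestronglyMeasurable D
      (Filter.Eventually.of_forall fun _ => hvD _)
  have e1 : ∫ ν, (∫ s, v s ∂(ν : Measure S)) ∂(M.measurized.trans p) =
      ∫ k, ∫ s, v s ∂(M.Q k) ∂(p.joint : Measure M.K) := by
    refine (Kernel.integral_deterministic' LiftedPair.measurable_next
      (measurable_integral_probabilityMeasure hv).stronglyMeasurable).trans ?_
    exact integral_comp_measure
      (Integrable.of_bound hv.aestronglyMeasurable D (Filter.Eventually.of_forall hvD))
  have e2 : ∫ s, v s ∂(p.dist : Measure S) = ∫ k, v k.1.1 ∂(p.joint : Measure M.K) := by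
    rw [← p.map_joint, integral_map hstate.aemeasurable hv.aestronglyMeasurable]
  have e3 := integral_sub (i1.add (i2.const_mul α)) i3
  rw [integral_add' i1 (i2.const_mul α), integral_const_mul, ← e1, ← e2] at e3
  exact e3.symm

lemma LiftedPair.measurable_mk (φ : M.DecisionRule) :
    Measurable fun ν : ProbabilityMeasure S => (⟨ν, φ⟩ : M.LiftedPair) := by
  have h : Measurable fun ν : ProbabilityMeasure S =>
      M.pairKernel id measurable_id φ.kernel ∘ₘ (ν : Measure S) :=
    (Measure.measurable_bind' (Kernel.measurable _)).comp measurable_subtype_coe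
  exact measurable_comap_iff.2 (Measurable.subtype_mk h)

/-- The policy of the measurized model that always uses the same decision rule. -/
def liftedStationaryPolicy [MeasurableSpace.CountablyGenerated S] (M : MarkovDecisionModel S U)
    (φ : M.DecisionRule) : M.measurized.Policy where
  kernel _ := Kernel.deterministic (fun a => ⟨a.2, φ⟩)
    ((LiftedPair.measurable_mk φ).comp measurable_snd)
  isMarkov _ := inferInstance
  feasible _ h ν := by
    have hm : MeasurableSet {p : M.LiftedPair | p.dist = ν} :=
      LiftedPair.measurable_dist (measurableSet_eq_probabilityMeasure ν)
    rw [Kernel.deterministic_apply]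
    exact (ae_dirac_iff hm).2 rfl

end Lift

/-! ### Identification of both optimal values. -/

/-- The stationary policy of the selector attains the upper bound `v`, so the real supremum is a
maximum and takes no default value. -/
lemma optimalValue_eq [MeasurableSingletonClass S] {α C D : ℝ} (hα0 : 0 ≤ α) (hα1 : α < 1)
    (hC : ∀ k, |M.r k| ≤ C) {v : S → ℝ} (hv : Measurable v) (hvD : ∀ s, |v s| ≤ D)
    (hle : ∀ k, M.toControlModel.bellmanGap α v k ≤ 0) {g : S → U} (hg : Measurable g)
    (hK : ∀ s, (s, g s) ∈ M.K) (heq : ∀ s, M.toControlModel.bellmanGap α v ⟨(s, g s), hK s⟩ = 0)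
    (s : S) : M.optimalValue α s = v s := by
  refine IsGreatest.csSup_eq ⟨⟨M.stationaryPolicy hg hK, ?_⟩, ?_⟩
  · refine ControlModel.Policy.value_eq _ hα0 hα1 hC hv hvD (fun t a => ?_) s
    exact ae_pairKernel_deterministic measurable_snd (hg.comp measurable_snd) (fun a => hK a.2)
      (ControlModel.measurable_bellmanGap α hv (measurableSet_singleton 0)) (fun a => heq a.2) a
  · rintro _ ⟨π, rfl⟩
    exact π.toControlPolicy.value_le hα0 hα1 hC hv hvD hle s

/-- The decision rule of `g` has zero lifted gap at every `ν`, so repeating it is optimal and no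
selection over the space of laws is needed. -/
lemma measurizedOptimalValue_eq [MeasurableSpace.CountablyGenerated S] {α C D : ℝ} (hα0 : 0 ≤ α)
    (hα1 : α < 1) (hC : ∀ k, |M.r k| ≤ C) {v : S → ℝ} (hv : Measurable v) (hvD : ∀ s, |v s| ≤ D)
    (hle : ∀ k, M.toControlModel.bellmanGap α v k ≤ 0) {g : S → U} (hg : Measurable g)
    (hK : ∀ s, (s, g s) ∈ M.K) (heq : ∀ s, M.toControlModel.bellmanGap α v ⟨(s, g s), hK s⟩ = 0)
    (ν : ProbabilityMeasure S) :
    M.measurizedOptimalValue α ν = ∫ s, v s ∂(ν : Measure S) := by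
  have hw := measurable_integral_probabilityMeasure hv
  have hwD : ∀ ν : ProbabilityMeasure S, |∫ s, v s ∂(ν : Measure S)| ≤ D := fun ν => by
    simpa using norm_integral_le_of_norm_le_const (μ := (ν : Measure S)) (f := v) (C := D)
      (Filter.Eventually.of_forall hvD)
  have hCl : ∀ p, |M.measurized.reward p| ≤ C := fun p => by
    have := norm_integral_le_of_norm_le_const (μ := (p.joint : Measure M.K)) (f := M.r)
      (C := C) (Filter.Eventually.of_forall hC)
    rwa [probReal_univ, mul_one] at this
  refine IsGreatest.csSup_eq
    ⟨⟨M.liftedStationaryPolicy (M.selectorRule hg hK), ?_⟩, ?_⟩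
  · refine ControlModel.Policy.value_eq _ hα0 hα1 hCl hw hwD (fun t a => ?_) ν
    refine (ae_dirac_iff (ControlModel.measurable_bellmanGap α hw (measurableSet_singleton 0))).2 ?_
    rw [bellmanGap_measurized hC hv hvD]
    refine integral_eq_zero_of_ae ?_
    have hms := ControlModel.measurable_bellmanGap (M := M.toControlModel) α hv
      (measurableSet_singleton 0)
    exact (Measure.ae_comp_iff hms).2 (Filter.Eventually.of_forall fun s =>
      ae_pairKernel_deterministic measurable_id hg hK hms heq s)
  · rintro _ ⟨π, rfl⟩
    refine π.value_le hα0 hα1 hCl hw hwD (fun p => ?_) ν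
    rw [bellmanGap_measurized hC hv hvD]
    exact integral_nonpos hle

end MarkovDecisionModel

end

/-! ### The strong law for the optimal value. -/

theorem corollary5p1
    {S U : Type*}
    [TopologicalSpace S] [TopologicalSpace.MetrizableSpace S] [SecondCountableTopology S]
    [MeasurableSpace S] [BorelSpace S] [StandardBorelSpace S]
    [TopologicalSpace U] [TopologicalSpace.MetrizableSpace U] [SecondCountableTopology U]
    [MeasurableSpace U] [BorelSpace U] [StandardBorelSpace U]
    (M : MarkovDecisionModel S U) (α : ℝ) (hα0 : 0 ≤ α) (hα1 : α < 1)
    (hr : M.RewardRegular) (hQ : M.StronglyContinuous) (hfin : M.HasFinitePolicy α)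
    (hbelow : BddBelow (Set.range M.r)) (hcomp : M.CompactOverCompact)
    (ν : ProbabilityMeasure S)
    {Ω : Type*} [MeasurableSpace Ω] (P : Measure Ω) [IsProbabilityMeasure P]
    (X : ℕ → Ω → S) (hlaw : ∀ n, HasLaw (X n) (ν : Measure S) P) (hindep : iIndepFun X P) :
    ∀ᵐ ω ∂P, Filter.Tendsto
      (fun N : ℕ => (1 / (N : ℝ)) * ∑ n ∈ Finset.range N, M.optimalValue α (X n ω))
      Filter.atTop (nhds (M.measurizedOptimalValue α ν)) := by
  obtain ⟨C, hC0, hC⟩ : ∃ C, 0 ≤ C ∧ ∀ k, |M.r k| ≤ C := by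
    obtain ⟨a, ha⟩ := hr.bddAbove
    obtain ⟨b, hb⟩ := hbelow
    exact ⟨|a| + |b|, by positivity, fun k => abs_le.2
      ⟨by linarith [hb ⟨k, rfl⟩, neg_abs_le b, abs_nonneg a],
        by linarith [ha ⟨k, rfl⟩, le_abs_self a, abs_nonneg b]⟩⟩
  have hα : 0 < 1 - α := sub_pos.2 hα1
  -- The radius `C / (1 - α)` solves `C + α * D = D`.
  obtain ⟨v, hv, hvD, hfix⟩ := MarkovDecisionModel.exists_bellman_fixedPoint
    (D := C / (1 - α)) hα0 hα1 hC (by positivity) (le_of_eq (by field_simp; ring))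
    hr.upperSemicontinuous hQ hcomp
  -- Applying the operator once more, to `v` itself, supplies a selector; its values equal `v`
  -- because greatest elements are unique.
  obtain ⟨g, hK, hg, -, him⟩ := MarkovDecisionModel.exists_isBellmanImage
    hr.upperSemicontinuous hQ hcomp hv hvD
  have hle : ∀ k, M.toControlModel.bellmanGap α v k ≤ 0 := fun k =>
    sub_nonpos.2 ((hfix k.1.1).2 ⟨k.1.2, k.2, rfl⟩)
  have heq : ∀ s, M.toControlModel.bellmanGap α v ⟨(s, g s), hK s⟩ = 0 := fun s =>
    sub_eq_zero.2 ((him s).unique (hfix s))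
  rw [MarkovDecisionModel.measurizedOptimalValue_eq hα0 hα1 hC hv hvD hle hg hK heq]
  simp only [MarkovDecisionModel.optimalValue_eq hα0 hα1 hC hv hvD hle hg hK heq]
  have hint : Integrable (fun ω => v (X 0 ω)) P :=
    Integrable.of_bound (hv.comp_aemeasurable (hlaw 0).aemeasurable).aestronglyMeasurable _
      (Filter.Eventually.of_forall fun ω => hvD _)
  have hmean : ∫ ω, v (X 0 ω) ∂P = ∫ s, v s ∂(ν : Measure S) := by
    rw [← (hlaw 0).map_eq, integral_map (hlaw 0).aemeasurable hv.aestronglyMeasurable]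
  have hslln := strong_law_ae_real (fun n ω => v (X n ω)) hint
    (fun i j hij => (hindep.indepFun hij).comp hv hv)
    (fun i => IdentDistrib.comp ⟨(hlaw i).aemeasurable, (hlaw 0).aemeasurable,
      (hlaw i).map_eq.trans (hlaw 0).map_eq.symm⟩ hv)
  filter_upwards [hslln] with ω hω
  rw [hmean] at hω
  refine hω.congr fun N => ?_
  rw [one_div, div_eq_inv_mul]
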